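/- **Theorem 2 (Oracle property of bridge estimators).** Setting. For each sample size $n$ consider the linear model $Y_{i}=\mathbf x_i'\boldsymbol\beta_0+\varepsilon_i$, $i=1,\dots,n$, with fixed covariates $\mathbf x_i=(\mathbf w_i',\mathbf z_i')'\in\mathbb R^{p_n}$, $\mathbf w_i\in\mathbb R^{k_n}$, $\mathbf z_i\in\mathbb R^{m_n}$, $p_n=k_n+m_n$, and true coefficient $\boldsymbol\beta_0=(\boldsymbol\beta_{10}',\boldsymbol\beta_{20}')'$ with $\boldsymbol\beta_{10}\in\mathbb R^{k_n}$, $\boldsymbol\beta_{10}\ne\mathbf 0$ and $\boldsymbol\beta_{20}=\mathbf 0\in\mathbb R^{m_n}$ ($\mathbf x_i$, $\boldsymbol\beta_0$, $k_n$, $m_n$ may all depend on $n$). The covariates are standardized: $\sum_{i=1}^n x_{ij}=0$ and $n^{-1}\sum_{i=1}^n x_{ij}^2=1$ for all $j$. Let $\Sigma_n=n^{-1}\sum_{i=1}^n\mathbf x_i\mathbf x_i'$ and $\Sigma_{1n}=n^{-1}\sum_{i=1}^n\mathbf w_i\mathbf w_i'$, let $\rho_{1n}$ be the smallest eigenvalue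 of $\Sigma_n$, and let $\tau_{1n}$, $\tau_{2n}$ be the smallest and the largest eigenvalue of $\Sigma_{1n}$. Let $(\lambda_n)$ be a sequence of penalty parameters and $0<\gamma<1$, and let $\widehat{\boldsymbol\beta}_n=(\widehat{\boldsymbol\beta}_{1n}',\widehat{\boldsymbol\beta}_{2n}')'$ (a random vector, partitioned like $\boldsymbol\beta_0$) be a global minimizer over $\boldsymbol\beta\in\mathbb R^{p_n}$ of $$L_n(\boldsymbol\beta)=\sum_{i=1}^n(Y_i-\mathbf x_i'\boldsymbol\beta)^2+\lambda_n\sum_{j=1}^{p_n}|\beta_j|^\gamma .$$ Assume (conditions on individual $n$ being required for all sufficiently large $n$): - (A1) $\varepsilon_1,\varepsilon_2,\dots$ are independent and identically distributed with mean $0$ and variance $\sigma^2$, $0<\sigma^2<\infty$. - (A2) (a) $\rho_{1n}>0$; (b) $(p_n+\lambda_nk_n)(n\rho_{1n})^{-1}\to0$. - (A3) (a) $\lambda_n(k_n/n)^{1/2}\to0$; (b) $\lambda_nn^{-\gamma/2}(\rho_{1n}/\sqrt{p_n})^{2-\gamma}\to\infty$. - (A4) There are constants $0<b_0<b_1<\infty$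 with $b_0\le|\beta_{10,j}|\le b_1$ for $1\le j\le k_n$. - (A5) (a) There are constants $0<\tau_1<\tau_2<\infty$ with $\tau_1\le\tau_{1n}\le\tau_{2n}\le\tau_2$; (b) $n^{-1/2}\max_{1\le i\le n}\mathbf w_i'\mathbf w_i\to0$. Then: (i) $P(\widehat{\boldsymbol\beta}_{2n}=\mathbf 0)\to1$. (ii) For $\boldsymbol\alpha\in\mathbb R^{k_n}$ with $\boldsymbol\alpha\neq\mathbf 0$ and $\|\boldsymbol\alpha\|_2\le1$, put $s_n(\boldsymbol\alpha)=(\sigma^2\boldsymbol\alpha'\Sigma_{1n}^{-1}\boldsymbol\alpha)^{1/2}$. Then $$n^{1/2}s_n(\boldsymbol\alpha)^{-1}\boldsymbol\alpha'(\widehat{\boldsymbol\beta}_{1n}-\boldsymbol\beta_{10})=n^{-1/2}s_n(\boldsymbol\alpha)^{-1}\sum_{i=1}^n\varepsilon_i\,\boldsymbol\alpha'\Sigma_{1n}^{-1}\mathbf w_i+R_n(\boldsymbol\alpha),$$ where $\sup_{0<\|\boldsymbol\alpha\|_2\le1}|R_n(\boldsymbol\alpha)|\to0$ in probability; and for every sequence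 $\boldsymbol\alpha_n\in\mathbb R^{k_n}$ with $0<\|\boldsymbol\alpha_n\|_2\le1$, $$n^{1/2}s_n(\boldsymbol\alpha_n)^{-1}\boldsymbol\alpha_n'(\widehat{\boldsymbol\beta}_{1n}-\boldsymbol\beta_{10})\to_D N(0,1).$$ -/

import Mathlib

open Filter Topology MeasureTheory ProbabilityTheory
open scoped Matrix

noncomputable section

namespace Bridge

/-- The bridge objective `∑ᵢ (Yᵢ - xᵢ'β)² + lam * ∑ⱼ |βⱼ|^γ`; the rows of `X` are the `xᵢ'`. -/
def objective {n : ℕ} {ι : Type*} [Fintype ι] (X : Matrix (Fin n) ι ℝ) (Y : Fin n → ℝ)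
    (lam γ : ℝ) (β : EuclideanSpace ℝ ι) : ℝ :=
  (∑ i, (Y i - ∑ j, X i j * β j) ^ 2) + lam * ∑ j, |β j| ^ γ

/-- `β` is a global minimizer of the bridge objective, that is, a bridge estimate. -/
def IsBridgeEstimate {n : ℕ} {ι : Type*} [Fintype ι] (X : Matrix (Fin n) ι ℝ) (Y : Fin n → ℝ)
    (lam γ : ℝ) (β : EuclideanSpace ℝ ι) : Prop :=
  ∀ b : EuclideanSpace ℝ ι, objective X Y lam γ β ≤ objective X Y lam γ b

/-- The response vector of the linear model, `Yᵢ = xᵢ'β + eᵢ`. -/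
def response {n : ℕ} {ι : Type*} [Fintype ι] (X : Matrix (Fin n) ι ℝ) (β : EuclideanSpace ℝ ι)
    (e : Fin n → ℝ) : Fin n → ℝ :=
  fun i => (∑ j, X i j * β j) + e i

/-- The first block of a coefficient vector. -/
def block1 {k m : ℕ} (β : EuclideanSpace ℝ (Fin k ⊕ Fin m)) : EuclideanSpace ℝ (Fin k) :=
  WithLp.toLp 2 (fun j => β (Sum.inl j))

/-- The second block of a coefficient vector. -/
def block2 {k m : ℕ} (β : EuclideanSpace ℝ (Fin k ⊕ Fin m)) : EuclideanSpace ℝ (Fin m) :=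
  WithLp.toLp 2 (fun j => β (Sum.inr j))

/-- The columns of the design belonging to the first block; row `i` is `wᵢ'`. -/
def design1 {n k m : ℕ} (X : Matrix (Fin n) (Fin k ⊕ Fin m) ℝ) : Matrix (Fin n) (Fin k) ℝ :=
  X.submatrix id Sum.inl

/-- `n⁻¹ X'X`. -/
def gram {n : ℕ} {ι : Type*} (X : Matrix (Fin n) ι ℝ) : Matrix ι ι ℝ :=
  (n : ℝ)⁻¹ • (Xᵀ * X)

/-- The smallest eigenvalue of a real symmetric matrix of positive size
(its spectrum is then a nonempty finite set of reals). -/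
def minEigenvalue {ι : Type*} [Fintype ι] [DecidableEq ι] (A : Matrix ι ι ℝ) : ℝ :=
  sInf (spectrum ℝ A)

/-- The largest eigenvalue of a real symmetric matrix of positive size. -/
def maxEigenvalue {ι : Type*} [Fintype ι] [DecidableEq ι] (A : Matrix ι ι ℝ) : ℝ :=
  sSup (spectrum ℝ A)

/-- `s = (σ² α' S⁻¹ α)^{1/2}`. -/
def asympSD {k : ℕ} (σ : ℝ) (S : Matrix (Fin k) (Fin k) ℝ) (α : EuclideanSpace ℝ (Fin k)) : ℝ :=
  √(σ ^ 2 * (α.ofLp ⬝ᵥ (S⁻¹ *ᵥ α.ofLp)))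

/-- `n^{1/2} s⁻¹ α'(b - b₀)`, where `s` is computed from `S`. -/
def standardizedError {k : ℕ} (n : ℕ) (σ : ℝ) (S : Matrix (Fin k) (Fin k) ℝ)
    (α b b₀ : EuclideanSpace ℝ (Fin k)) : ℝ :=
  √(n : ℝ) * (asympSD σ S α)⁻¹ * (α.ofLp ⬝ᵥ (b - b₀).ofLp)

/-- `n^{-1/2} s⁻¹ ∑ᵢ eᵢ α' S⁻¹ wᵢ`, where `S = n⁻¹ W'W` and `wᵢ'` is row `i` of `W`. -/
def oracleTerm {n k : ℕ} (σ : ℝ) (W : Matrix (Fin n) (Fin k) ℝ) (e : Fin n → ℝ)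
    (α : EuclideanSpace ℝ (Fin k)) : ℝ :=
  (√(n : ℝ))⁻¹ * (asympSD σ (gram W) α)⁻¹ *
    ∑ i, e i * (α.ofLp ⬝ᵥ ((gram W)⁻¹ *ᵥ W i))

end Bridge

end

/-! Write u for the estimation error, v = X'e, G for the Gram matrix, ρ for its smallest eigenvalue
and p = k + m. Both v'G⁻¹v and v'v have mean σ²np (`integral_quadratic_form`), so by Markov each is
at most Knp outside an event of probability σ²/K. On the remaining event the argument is
deterministic (`eventually_oracle_of_quadratic_forms_le`).

Comparing the minimizer with the truth bounds ‖u‖² by a multiple of (p + λk)/(nρ), which tends to 0;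
hence the estimates of the nonzero coefficients stay above b₀/2 in modulus. Away from zero the
penalty has bounded slope, so its possible gain is linear in ‖u‖, and the same comparison now yields
‖u‖ = O(√(p/n)/ρ). On the other hand, a nonzero coordinate of a minimizer satisfies |βⱼ|^(2-γ) ≥
cλ/n (`IsBridgeEstimate.threshold`). By `hA3b` this level exceeds the rate, so the second block is
exactly zero.

With that block gone, the first-block scores are O(λ) (`IsBridgeEstimate.abs_score_le`), and
inverting the approximate normal equations leaves a remainder O(λ√(k/n)), uniformly in the
direction. The leading term is a weighted i.i.d. sum with unit sum of squared weights and vanishing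
maximal weight; a characteristic function argument and Slutsky's theorem give normality. -/

namespace Bridge

/-! ### Noise moments, a weighted central limit theorem, Markov's inequality -/

section Probability

/-- Telescoping: exchange one factor at a time, all other factors having modulus at most one. -/
lemma norm_prod_sub_prod_le {ι : Type*} (s : Finset ι) (x y : ι → ℂ) (hx : ∀ i, ‖x i‖ ≤ 1)
    (hy : ∀ i, ‖y i‖ ≤ 1) : ‖∏ i ∈ s, x i - ∏ i ∈ s, y i‖ ≤ ∑ i ∈ s, ‖x i - y i‖ := by
  classical
  induction s using Finset.induction_on with
  | empty => simp
  | insert a s ha ih =>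
    rw [Finset.prod_insert ha, Finset.prod_insert ha, Finset.sum_insert ha]
    have h1 : ‖∏ i ∈ s, y i‖ ≤ 1 := by
      rw [norm_prod]
      exact Finset.prod_le_one (fun i _ => norm_nonneg _) fun i _ => hy i
    calc ‖x a * ∏ i ∈ s, x i - y a * ∏ i ∈ s, y i‖
        = ‖x a * (∏ i ∈ s, x i - ∏ i ∈ s, y i) + (x a - y a) * ∏ i ∈ s, y i‖ := by
          congr 1; ring
      _ ≤ ‖x a‖ * ‖∏ i ∈ s, x i - ∏ i ∈ s, y i‖ + ‖x a - y a‖ * ‖∏ i ∈ s, y i‖ := by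
          rw [← norm_mul, ← norm_mul]; exact norm_add_le _ _
      _ ≤ 1 * ‖∏ i ∈ s, x i - ∏ i ∈ s, y i‖ + ‖x a - y a‖ * 1 := by
          gcongr
          exact hx a
      _ ≤ _ := by linarith

variable {Ω : Type*} [MeasurableSpace Ω] {P : Measure Ω}

lemma integral_mul_of_iIndepFun {ε : ℕ → Ω → ℝ} {σ : ℝ} (hindep : iIndepFun ε P)
    (hL2 : ∀ i, MemLp (ε i) 2 P) (hmean : ∀ i, ∫ ω, ε i ω ∂P = 0)
    (hvar : ∀ i, variance (ε i) P = σ ^ 2) (i j : ℕ) :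
    ∫ ω, ε i ω * ε j ω ∂P = if i = j then σ ^ 2 else 0 := by
  split_ifs with h
  · subst h
    rw [← hvar i, variance_of_integral_eq_zero (hL2 i).aemeasurable (hmean i)]
    simp [sq]
  · rw [(hindep.indepFun h).integral_fun_mul_eq_mul_integral (hL2 i).aestronglyMeasurable
      (hL2 j).aestronglyMeasurable, hmean i, zero_mul]

/-- The mean of the quadratic form `(X'e)' B (X'e)` in white noise `e`. -/
lemma integral_quadratic_form {ε : ℕ → Ω → ℝ} {σ : ℝ} (hindep : iIndepFun ε P)
    (hL2 : ∀ i, MemLp (ε i) 2 P) (hmean : ∀ i, ∫ ω, ε i ω ∂P = 0)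
    (hvar : ∀ i, variance (ε i) P = σ ^ 2) {n : ℕ} {ι : Type*} [Fintype ι]
    (X : Matrix (Fin n) ι ℝ) (B : Matrix ι ι ℝ) :
    Integrable (fun ω => (Xᵀ *ᵥ fun i => ε i ω) ⬝ᵥ (B *ᵥ (Xᵀ *ᵥ fun i => ε i ω))) P ∧
    ∫ ω, (Xᵀ *ᵥ fun i => ε i ω) ⬝ᵥ (B *ᵥ (Xᵀ *ᵥ fun i => ε i ω)) ∂P =
      σ ^ 2 * (B * (Xᵀ * X)).trace := by
  have hint (i j : Fin n) : Integrable (fun ω => ε i ω * ε j ω) P := (hL2 i).integrable_mul (hL2 j)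
  let M : Fin n → Fin n → ℝ := fun i j => (X * B * Xᵀ) i j
  have hexp (ω : Ω) : (Xᵀ *ᵥ fun i => ε i ω) ⬝ᵥ (B *ᵥ (Xᵀ *ᵥ fun i => ε i ω)) =
      ∑ i : Fin n, ∑ j : Fin n, M i j * (ε i ω * ε j ω) := by
    rw [Matrix.mulVec_mulVec, Matrix.mulVec_transpose, ← Matrix.dotProduct_mulVec,
      Matrix.mulVec_mulVec, ← Matrix.mul_assoc, dotProduct]
    refine Finset.sum_congr rfl fun i _ => ?_
    rw [Matrix.mulVec, dotProduct, Finset.mul_sum]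
    exact Finset.sum_congr rfl fun j _ => by ring
  simp only [hexp]
  have hint' (i : Fin n) : Integrable (fun ω => ∑ j : Fin n, M i j * (ε i ω * ε j ω)) P :=
    integrable_finsetSum _ fun j _ => (hint i j).const_mul _
  refine ⟨integrable_finsetSum _ fun i _ => hint' i, ?_⟩
  rw [integral_finsetSum _ fun i _ => hint' i]
  have (i : Fin n) : ∫ ω, ∑ j : Fin n, M i j * (ε i ω * ε j ω) ∂P = σ ^ 2 * M i i := by
    rw [integral_finsetSum _ fun j _ => (hint i j).const_mul _]
    simp only [integral_const_mul, integral_mul_of_iIndepFun hindep hL2 hmean hvar, Fin.val_inj]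
    simp [mul_comm]
  simp only [this, ← Finset.mul_sum]
  congr 1
  rw [← Matrix.mul_assoc, Matrix.trace_mul_comm (B * Xᵀ) X, ← Matrix.mul_assoc, Matrix.trace]
  rfl

variable [IsProbabilityMeasure P]

/-- Equal first two moments give equal second-order Taylor polynomials at 0, which cancel. -/
lemma charFun_sub_charFun_gaussianReal_isLittleO {X : Ω → ℝ} (hX : AEMeasurable X P)
    (h0 : P[X] = 0) (h1 : P[X ^ 2] = 1) :
    (fun t => charFun (P.map X) t - charFun (gaussianReal 0 1) t) =o[𝓝 0]
      fun t : ℝ => (t : ℂ) ^ 2 := by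
  have hg := taylor_charFun_two (P := gaussianReal 0 1) (X := id) aemeasurable_id
    (by simp [integral_id_gaussianReal]) (by
      have := variance_id_gaussianReal (μ := 0) (v := 1)
      rw [variance_of_integral_eq_zero aemeasurable_id (by simp [integral_id_gaussianReal])] at this
      simpa using this)
  rw [Measure.map_id] at hg
  have := (taylor_charFun_two hX h0 h1).sub hg
  have h2 : (fun t : ℝ => t ^ 2) =O[𝓝 0] fun t : ℝ => (t : ℂ) ^ 2 :=
    Asymptotics.IsBigO.of_bound 1 (by simp)
  refine (this.congr_left fun t => by ring).trans_isBigO ?_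
  exact_mod_cast h2

/-- A central limit theorem for weighted sums of i.i.d. variables with uniformly small weights. -/
theorem tendstoInDistribution_weighted_sum {ε : ℕ → Ω → ℝ} (hindep : iIndepFun ε P)
    (hident : ∀ i, IdentDistrib (ε i) (ε 0) P P) (h0 : P[ε 0] = 0) (h1 : P[ε 0 ^ 2] = 1)
    (a : ∀ n, Fin n → ℝ) (ha : ∀ᶠ n in atTop, ∑ i, a n i ^ 2 = 1)
    (hmax : ∀ δ : ℝ, 0 < δ → ∀ᶠ n in atTop, ∀ i, |a n i| ≤ δ) :
    TendstoInDistribution (fun n ω => ∑ i, a n i * ε i ω) atTop (id : ℝ → ℝ)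
      (fun _ => P) (gaussianReal 0 1) where
  forall_aemeasurable n :=
    Finset.aemeasurable_fun_sum _ fun i _ => (hident i).aemeasurable_fst.const_mul _
  aemeasurable_limit := aemeasurable_id
  tendsto := by
    have hm i := (hident i).aemeasurable_fst
    have : IsProbabilityMeasure (P.map (ε 0)) := Measure.isProbabilityMeasure_map (hm 0)
    refine ProbabilityMeasure.tendsto_iff_tendsto_charFun.2 fun t => ?_
    simp only [ProbabilityMeasure.coe_mk, Measure.map_id]
    have hprod (n : ℕ) : charFun (P.map fun ω => ∑ i, a n i * ε i ω) t =
        ∏ i, charFun (P.map (ε 0)) (a n i * t) := by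
      have hi : iIndepFun (fun (i : Fin n) ω => a n i * ε i ω) P :=
        (hindep.precomp Fin.val_injective).comp (fun i x => a n i * x)
          (fun i => measurable_const_mul _)
      rw [hi.charFun_map_fun_sum_eq_prod fun i : Fin n => (hm i).const_mul (a n i)]
      simp only [Finset.prod_apply]
      refine Finset.prod_congr rfl fun i _ => ?_
      rw [charFun_map_mul_comp (hm i), (hident i).map_eq]
    -- As the squared weights sum to one, the Gaussian factorizes along the same weights, which
    -- allows a factorwise comparison.
    have hgauss {n : ℕ} (hn : ∑ i, a n i ^ 2 = 1) : charFun (gaussianReal 0 1) t =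
        ∏ i, charFun (gaussianReal 0 1) (a n i * t) := by
      simp only [charFun_gaussianReal, ← Complex.exp_sum]
      congr 1
      have : (∑ i, (a n i : ℂ) ^ 2) = 1 := by exact_mod_cast hn
      simp only [Complex.ofReal_zero, mul_zero, zero_mul, zero_sub, Finset.sum_neg_distrib,
        ← Finset.sum_div, Complex.ofReal_mul, mul_pow, ← Finset.mul_sum, ← Finset.sum_mul, this]
      simp
    have hsmall := charFun_sub_charFun_gaussianReal_isLittleO (hm 0) h0 h1
    rw [tendsto_iff_norm_sub_tendsto_zero, Metric.tendsto_atTop']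
    intro c hc
    -- Summed over i, this tolerance costs c t²/(2(t² + 1)) < c; the added 1 covers t = 0.
    have hc' : 0 < c / (2 * (t ^ 2 + 1)) := by positivity
    obtain ⟨r, hr, hball⟩ := Metric.eventually_nhds_iff.1 (hsmall.def hc')
    have hev := (hmax (r / (2 * (|t| + 1))) (by positivity)).and ha
    obtain ⟨N, hN⟩ := eventually_atTop.1 hev
    refine ⟨N, fun n hn => ?_⟩
    obtain ⟨hsm, hsum⟩ := hN n hn.le
    rw [dist_zero_right, norm_norm, hprod, hgauss hsum]
    refine (norm_prod_sub_prod_le _ _ _ (fun i => norm_charFun_le_one _)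
      fun i => norm_charFun_le_one _).trans_lt ?_
    calc ∑ i, ‖charFun (P.map (ε 0)) (a n i * t) - charFun (gaussianReal 0 1) (a n i * t)‖
        ≤ ∑ i, c / (2 * (t ^ 2 + 1)) * (a n i ^ 2 * t ^ 2) := by
          refine Finset.sum_le_sum fun i _ => ?_
          have : dist (a n i * t) 0 < r := by
            rw [dist_zero_right, Real.norm_eq_abs, abs_mul]
            calc |a n i| * |t| ≤ r / (2 * (|t| + 1)) * (|t| + 1) := by
                  gcongr
                  · exact hsm i
                  · linarith
              _ = r / 2 := by field_simp
              _ < r := by linarith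
          have := hball this
          rw [norm_pow, Complex.norm_real, Real.norm_eq_abs, sq_abs, mul_pow] at this
          exact this
      _ = c * (t ^ 2 / (2 * (t ^ 2 + 1))) := by
          rw [← Finset.mul_sum, ← Finset.sum_mul, hsum]; ring
      _ < c * 1 := by
          gcongr
          rw [div_lt_one (by positivity)]
          nlinarith [sq_nonneg t]
      _ = c := mul_one c

/-- Markov's inequality, for a nonnegative function with known mean. -/
lemma measure_lt_le_of_integral_eq {f : Ω → ℝ} (hf : Integrable f P) (hf0 : ∀ ω, 0 ≤ f ω)
    {a b K : ℝ} (hK : 0 < K) (hb : 0 < b) (hfa : ∫ ω, f ω ∂P = a * b) :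
    P {ω | K * b < f ω} ≤ ENNReal.ofReal (a / K) := by
  have h := mul_meas_ge_le_integral_of_nonneg (ae_of_all P hf0) hf (K * b)
  rw [hfa] at h
  have h2 : P.real {ω | K * b ≤ f ω} ≤ a / K := by
    rw [le_div_iff₀ hK]
    nlinarith
  calc P {ω | K * b < f ω} ≤ P {ω | K * b ≤ f ω} :=
        measure_mono (Set.ofPred_subset_ofPred.2 fun ω => le_of_lt)
    _ = ENNReal.ofReal (P.real {ω | K * b ≤ f ω}) := (ofReal_measureReal).symm
    _ ≤ _ := ENNReal.ofReal_le_ofReal h2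

end Probability

/-! ### Gram matrices, Rayleigh bounds and Cauchy–Schwarz for A and A⁻¹ -/

section LinearAlgebra

variable {ι : Type*}

lemma gram_isHermitian {n : ℕ} (X : Matrix (Fin n) ι ℝ) : (gram X).IsHermitian := by
  have := Matrix.isHermitian_conjTranspose_mul_self X
  rw [Matrix.conjTranspose_eq_transpose_of_trivial] at this
  rw [gram, Matrix.IsHermitian, Matrix.conjTranspose_smul, this]
  simp

lemma smul_gram {n : ℕ} (hn : 0 < n) (X : Matrix (Fin n) ι ℝ) : (n : ℝ) • gram X = Xᵀ * X := by
  rw [gram, smul_smul, mul_inv_cancel₀ (by positivity), one_smul]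

variable [Fintype ι]

lemma mul_dotProduct_gram_mulVec {n : ℕ} (hn : 0 < n) (X : Matrix (Fin n) ι ℝ) (u : ι → ℝ) :
    (n : ℝ) * (u ⬝ᵥ (gram X *ᵥ u)) = (X *ᵥ u) ⬝ᵥ (X *ᵥ u) := by
  rw [← smul_eq_mul, ← dotProduct_smul, ← Matrix.smul_mulVec, smul_gram hn,
    ← Matrix.mulVec_mulVec, Matrix.dotProduct_mulVec, Matrix.vecMul_transpose]

lemma dotProduct_self_nonneg_of_real (a : ι → ℝ) : 0 ≤ a ⬝ᵥ a :=
  Finset.sum_nonneg fun i _ => mul_self_nonneg (a i)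

lemma dotProduct_mulVec_comm {A : Matrix ι ι ℝ} (hA : A.IsHermitian) (a b : ι → ℝ) :
    a ⬝ᵥ (A *ᵥ b) = b ⬝ᵥ (A *ᵥ a) := by
  have hT : Aᵀ = A := by
    rw [← Matrix.conjTranspose_eq_transpose_of_trivial]; exact hA
  rw [Matrix.dotProduct_mulVec, ← Matrix.mulVec_transpose, hT, dotProduct_comm]

variable [DecidableEq ι]

lemma minEigenvalue_le {A : Matrix ι ι ℝ} {μ : ℝ} (hμ : μ ∈ spectrum ℝ A) :
    minEigenvalue A ≤ μ :=
  csInf_le A.finite_real_spectrum.bddBelow hμ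

/-- Shifting by a scalar shifts the spectrum, so a negative eigenvalue here would be a spectral
value of A below the infimum. -/
lemma posSemidef_sub_minEigenvalue {A : Matrix ι ι ℝ} (hA : A.IsHermitian) :
    (A - minEigenvalue A • (1 : Matrix ι ι ℝ)).PosSemidef := by
  have hB : (A - minEigenvalue A • (1 : Matrix ι ι ℝ)).IsHermitian :=
    hA.sub (by simp [Matrix.IsHermitian])
  rw [hB.posSemidef_iff_eigenvalues_nonneg]
  intro i
  have h := hB.eigenvalues_mem_spectrum_real i
  have h2 : minEigenvalue A + hB.eigenvalues i ∈ spectrum ℝ A := by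
    rw [add_comm]
    refine spectrum.add_mem_iff.2 ?_
    rwa [neg_add_eq_sub, Algebra.algebraMap_eq_smul_one]
  have := minEigenvalue_le h2
  simp only [Pi.zero_apply]
  linarith

lemma minEigenvalue_mul_le {A : Matrix ι ι ℝ} (hA : A.IsHermitian) (u : ι → ℝ) :
    minEigenvalue A * (u ⬝ᵥ u) ≤ u ⬝ᵥ (A *ᵥ u) := by
  have h := (posSemidef_sub_minEigenvalue hA).dotProduct_mulVec_nonneg u
  simp only [star_trivial, Matrix.sub_mulVec, Matrix.smul_mulVec, Matrix.one_mulVec,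
    dotProduct_sub, dotProduct_smul, smul_eq_mul] at h
  linarith

lemma posDef_of_minEigenvalue_pos {A : Matrix ι ι ℝ} (hA : A.IsHermitian)
    (h : 0 < minEigenvalue A) : A.PosDef := by
  refine Matrix.PosDef.of_dotProduct_mulVec_pos hA fun u hu => ?_
  rw [star_trivial]
  refine lt_of_lt_of_le (mul_pos h ?_) (minEigenvalue_mul_le hA u)
  simpa using Matrix.dotProduct_star_self_pos_iff.2 hu

lemma mulVec_inv_mulVec {A : Matrix ι ι ℝ} (hA : A.PosDef) (a : ι → ℝ) :
    A *ᵥ (A⁻¹ *ᵥ a) = a := by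
  rw [Matrix.mulVec_mulVec, Matrix.mul_nonsing_inv _ ((Matrix.isUnit_iff_isUnit_det _).1 hA.isUnit),
    Matrix.one_mulVec]

lemma inv_mulVec_mulVec {A : Matrix ι ι ℝ} (hA : A.PosDef) (a : ι → ℝ) :
    A⁻¹ *ᵥ (A *ᵥ a) = a := by
  rw [Matrix.mulVec_mulVec, Matrix.nonsing_inv_mul _ ((Matrix.isUnit_iff_isUnit_det _).1 hA.isUnit),
    Matrix.one_mulVec]

/-- The Cauchy–Schwarz inequality for the dual pair of norms given by `A⁻¹` and `A`. -/
lemma sq_dotProduct_le {A : Matrix ι ι ℝ} (hA : A.PosDef) (a u : ι → ℝ) :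
    (a ⬝ᵥ u) ^ 2 ≤ (a ⬝ᵥ (A⁻¹ *ᵥ a)) * (u ⬝ᵥ (A *ᵥ u)) := by
  -- The form of A at u - s A⁻¹a is a nonnegative quadratic in s; its discriminant gives the claim.
  have h (s : ℝ) : 0 ≤ (a ⬝ᵥ (A⁻¹ *ᵥ a)) * (s * s) + (-2 * (a ⬝ᵥ u)) * s + u ⬝ᵥ (A *ᵥ u) := by
    have h := hA.posSemidef.dotProduct_mulVec_nonneg (u - s • (A⁻¹ *ᵥ a))
    simp only [star_trivial, Matrix.mulVec_sub, Matrix.mulVec_smul, mulVec_inv_mulVec hA,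
      dotProduct_sub, sub_dotProduct, dotProduct_smul, smul_dotProduct, smul_eq_mul] at h
    rw [dotProduct_mulVec_comm hA.1 (A⁻¹ *ᵥ a) u, mulVec_inv_mulVec hA, dotProduct_comm u a,
      dotProduct_comm (A⁻¹ *ᵥ a) a] at h
    linarith
  have := discrim_le_zero h
  rw [discrim] at this
  linarith

lemma sq_dotProduct_inv_mulVec_le {A : Matrix ι ι ℝ} (hA : A.PosDef) (a b : ι → ℝ) :
    (a ⬝ᵥ (A⁻¹ *ᵥ b)) ^ 2 ≤ (a ⬝ᵥ (A⁻¹ *ᵥ a)) * (b ⬝ᵥ (A⁻¹ *ᵥ b)) := by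
  have h := sq_dotProduct_le hA a (A⁻¹ *ᵥ b)
  rwa [mulVec_inv_mulVec hA, dotProduct_comm (A⁻¹ *ᵥ b) b] at h

lemma sq_dotProduct_le_mul (a u : ι → ℝ) : (a ⬝ᵥ u) ^ 2 ≤ (a ⬝ᵥ a) * (u ⬝ᵥ u) := by
  simpa using sq_dotProduct_le (A := 1) Matrix.PosDef.one a u

lemma dotProduct_inv_mulVec_nonneg {A : Matrix ι ι ℝ} (hA : A.PosDef) (a : ι → ℝ) :
    0 ≤ a ⬝ᵥ (A⁻¹ *ᵥ a) := by
  simpa using hA.inv.posSemidef.dotProduct_mulVec_nonneg a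

lemma dotProduct_inv_mulVec_pos {A : Matrix ι ι ℝ} (hA : A.PosDef) {a : ι → ℝ} (ha : a ≠ 0) :
    0 < a ⬝ᵥ (A⁻¹ *ᵥ a) := by
  simpa using hA.inv.dotProduct_mulVec_pos ha

/-- The Rayleigh bound at A⁻¹a, combined with Cauchy–Schwarz for a and A⁻¹a, gives the claim times
a'A⁻¹a, which is then cancelled. -/
lemma mul_dotProduct_inv_mulVec_le {A : Matrix ι ι ℝ} (hA : A.IsHermitian) {c : ℝ} (hc : 0 < c)
    (hcA : c ≤ minEigenvalue A) (a : ι → ℝ) : c * (a ⬝ᵥ (A⁻¹ *ᵥ a)) ≤ a ⬝ᵥ a := by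
  have hP := posDef_of_minEigenvalue_pos hA (hc.trans_le hcA)
  have h1 := minEigenvalue_mul_le hA (A⁻¹ *ᵥ a)
  rw [mulVec_inv_mulVec hP, dotProduct_comm (A⁻¹ *ᵥ a) a] at h1
  have h2 := sq_dotProduct_le_mul a (A⁻¹ *ᵥ a)
  have h3 := dotProduct_self_nonneg_of_real (A⁻¹ *ᵥ a)
  have h4 := dotProduct_self_nonneg_of_real a
  have h5 : c * ((A⁻¹ *ᵥ a) ⬝ᵥ (A⁻¹ *ᵥ a)) ≤ a ⬝ᵥ (A⁻¹ *ᵥ a) :=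
    (mul_le_mul_of_nonneg_right hcA h3).trans h1
  rcases (dotProduct_inv_mulVec_nonneg hP a).eq_or_lt with h0 | h0
  · rw [← h0, mul_zero]; exact h4
  · refine le_of_mul_le_mul_right ?_ h0
    calc c * (a ⬝ᵥ (A⁻¹ *ᵥ a)) * (a ⬝ᵥ (A⁻¹ *ᵥ a)) = c * (a ⬝ᵥ (A⁻¹ *ᵥ a)) ^ 2 := by ring
      _ ≤ c * ((a ⬝ᵥ a) * ((A⁻¹ *ᵥ a) ⬝ᵥ (A⁻¹ *ᵥ a))) := by gcongr
      _ = (a ⬝ᵥ a) * (c * ((A⁻¹ *ᵥ a) ⬝ᵥ (A⁻¹ *ᵥ a))) := by ring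
      _ ≤ _ := by gcongr

end LinearAlgebra

/-! ### Concavity of the penalty -/

section RealPowers

/-- Only y has to stay away from zero: for x > y concavity bounds the increment by y^(γ-1)(x - y),
and for x ≤ y the left side is nonpositive. -/
lemma rpow_sub_rpow_le {γ a x y : ℝ} (hγ0 : 0 < γ) (hγ1 : γ < 1) (ha : 0 < a) (hx : 0 ≤ x)
    (hy : a ≤ y) :
    x ^ γ - y ^ γ ≤ a ^ (γ - 1) * |x - y| := by
  have hy0 : 0 < y := ha.trans_le hy
  rcases le_or_gt x y with h | h
  · have := Real.rpow_le_rpow hx h hγ0.le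
    have h2 : 0 ≤ a ^ (γ - 1) * |x - y| := by positivity
    linarith
  · have h1 : (x / y) ^ γ ≤ x / y :=
      (Real.rpow_le_rpow_of_exponent_le ((one_le_div hy0).2 h.le) hγ1.le).trans_eq (Real.rpow_one _)
    rw [Real.div_rpow hx hy0.le, div_le_div_iff₀ (by positivity) hy0] at h1
    have h2 : y ^ γ = y ^ (γ - 1) * y := by
      rw [Real.rpow_sub_one hy0.ne', div_mul_cancel₀ _ hy0.ne']
    have h3 : y ^ (γ - 1) ≤ a ^ (γ - 1) :=
      Real.rpow_le_rpow_of_nonpos ha hy (by linarith)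
    have h4 : x ^ γ ≤ x * y ^ (γ - 1) := by
      rw [h2, ← mul_assoc] at h1
      exact le_of_mul_le_mul_right h1 hy0
    rw [abs_of_pos (sub_pos.2 h), h2]
    nlinarith [mul_le_mul_of_nonneg_right h3 (sub_pos.2 h).le]

end RealPowers

/-! ### Consequences of global minimality -/

section Minimizers

variable {n : ℕ} {ι : Type*} [Fintype ι]

lemma IsBridgeEstimate.basic_inequality {X : Matrix (Fin n) ι ℝ} {β₀ β : EuclideanSpace ℝ ι}
    {e : Fin n → ℝ} {lam γ : ℝ} (hn : 0 < n)
    (h : IsBridgeEstimate X (response X β₀ e) lam γ β) :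
    (n : ℝ) * ((β.ofLp - β₀.ofLp) ⬝ᵥ (gram X *ᵥ (β.ofLp - β₀.ofLp))) ≤
      2 * ((Xᵀ *ᵥ e) ⬝ᵥ (β.ofLp - β₀.ofLp)) + lam * (∑ j, |β₀ j| ^ γ - ∑ j, |β j| ^ γ) := by
  have h0 := h β₀
  simp only [objective, response] at h0
  rw [mul_dotProduct_gram_mulVec hn, Matrix.mulVec_transpose, ← Matrix.dotProduct_mulVec,
    dotProduct, dotProduct]
  have h1 (i : Fin n) : ((∑ j, X i j * β₀ j) + e i - ∑ j, X i j * β j) ^ 2 =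
      e i ^ 2 + ((X *ᵥ (β.ofLp - β₀.ofLp)) i * (X *ᵥ (β.ofLp - β₀.ofLp)) i -
        2 * (e i * (X *ᵥ (β.ofLp - β₀.ofLp)) i)) := by
    rw [Matrix.mulVec_sub, Pi.sub_apply]
    simp only [Matrix.mulVec, dotProduct]
    ring
  have h2 (i : Fin n) : ((∑ j, X i j * β₀ j) + e i - ∑ j, X i j * β₀ j) ^ 2 = e i ^ 2 := by ring
  simp only [h1, h2, Finset.sum_add_distrib, Finset.sum_sub_distrib, ← Finset.mul_sum] at h0
  linarith

variable [DecidableEq ι]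

lemma IsBridgeEstimate.coordinate {X : Matrix (Fin n) ι ℝ} {Y : Fin n → ℝ}
    {β : EuclideanSpace ℝ ι} {lam γ : ℝ} (h : IsBridgeEstimate X Y lam γ β) (j : ι) (t : ℝ) :
    0 ≤ t ^ 2 * ∑ i, X i j ^ 2 - 2 * t * ∑ i, X i j * (Y i - ∑ l, X i l * β l) +
      lam * (|β j + t| ^ γ - |β j| ^ γ) := by
  have h0 := h (β + EuclideanSpace.single j t)
  simp only [objective] at h0
  have h1 (i : Fin n) : (Y i - ∑ l, X i l * (β + EuclideanSpace.single j t) l) ^ 2 =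
      (Y i - ∑ l, X i l * β l) ^ 2 + (t ^ 2 * X i j ^ 2 -
        2 * t * (X i j * (Y i - ∑ l, X i l * β l))) := by
    have : ∑ l, X i l * (β + EuclideanSpace.single j t) l = ∑ l, X i l * β l + X i j * t := by
      simp [mul_add, Finset.sum_add_distrib]
    rw [this]; ring
  have h2 : ∑ l, |(β + EuclideanSpace.single j t) l| ^ γ =
      ∑ l, |β l| ^ γ + (|β j + t| ^ γ - |β j| ^ γ) := by
    rw [← Finset.add_sum_erase _ _ (Finset.mem_univ j),
      ← Finset.add_sum_erase _ (fun l => |β l| ^ γ) (Finset.mem_univ j)]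
    have : ∑ l ∈ Finset.univ.erase j, |(β + EuclideanSpace.single j t) l| ^ γ =
        ∑ l ∈ Finset.univ.erase j, |β l| ^ γ :=
      Finset.sum_congr rfl fun l hl => by simp [Finset.ne_of_mem_erase hl]
    rw [this]
    simp only [PiLp.add_apply, PiLp.single_apply, if_pos]
    ring
  simp only [h1, h2, Finset.sum_add_distrib, Finset.sum_sub_distrib, ← Finset.mul_sum] at h0
  linarith

/-- A nonzero coordinate of a bridge estimate is bounded away from zero. -/
lemma IsBridgeEstimate.threshold {X : Matrix (Fin n) ι ℝ} {Y : Fin n → ℝ}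
    {β : EuclideanSpace ℝ ι} {lam γ : ℝ} (hγ0 : 0 < γ) (h : IsBridgeEstimate X Y lam γ β) (j : ι) :
    lam * (2 - 2 ^ γ) * |β j| ^ γ ≤ 2 * (∑ i, X i j ^ 2) * β j ^ 2 := by
  -- Delete the coordinate, then double it: the score term is odd in t and cancels in the sum.
  have h1 := h.coordinate j (-β j)
  have h2 := h.coordinate j (β j)
  have h3 : |β j + β j| ^ γ = 2 ^ γ * |β j| ^ γ := by
    rw [← two_mul, abs_mul, Real.mul_rpow (abs_nonneg _) (abs_nonneg _), abs_two]
  rw [add_neg_cancel, abs_zero, Real.zero_rpow hγ0.ne'] at h1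
  rw [h3] at h2
  nlinarith

/-- A substitute for stationarity without derivatives: for small steps t of both signs the quadratic
term is negligible, and the penalty changes by at most its slope bound times |t|. -/
lemma IsBridgeEstimate.abs_score_le {X : Matrix (Fin n) ι ℝ} {Y : Fin n → ℝ}
    {β : EuclideanSpace ℝ ι} {lam γ a : ℝ} (hγ0 : 0 < γ) (hγ1 : γ < 1) (hlam : 0 ≤ lam)
    (h : IsBridgeEstimate X Y lam γ β) {j : ι} (ha : 0 < a) (haj : a ≤ |β j|) :
    2 * |∑ i, X i j * (Y i - ∑ l, X i l * β l)| ≤ lam * a ^ (γ - 1) := by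
  set S := ∑ i, X i j ^ 2
  set C := ∑ i, X i j * (Y i - ∑ l, X i l * β l)
  have key (t : ℝ) : 2 * t * C ≤ t ^ 2 * S + lam * a ^ (γ - 1) * |t| := by
    have h1 := h.coordinate j t
    have h2 := rpow_sub_rpow_le hγ0 hγ1 ha (abs_nonneg (β j + t)) haj
    have h3 : |(|β j + t| - |β j|)| ≤ |t| := by
      simpa using abs_abs_sub_abs_le_abs_sub (β j + t) (β j)
    have h4 : |β j + t| ^ γ - |β j| ^ γ ≤ a ^ (γ - 1) * |t| :=
      h2.trans (mul_le_mul_of_nonneg_left h3 (by positivity))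
    have h5 := mul_le_mul_of_nonneg_left h4 hlam
    linarith
  have hS : 0 ≤ S := Finset.sum_nonneg fun i _ => sq_nonneg _
  refine le_of_forall_pos_le_add fun c hc => ?_
  -- This step makes tS ≤ c; the added 1 covers S = 0.
  have ht : 0 < c / (S + 1) := by positivity
  have hc' : c / (S + 1) * S ≤ c := by
    rw [div_mul_eq_mul_div, div_le_iff₀ (by positivity)]; nlinarith
  have k1 := key (c / (S + 1))
  have k2 := key (-(c / (S + 1)))
  rw [abs_neg] at k2
  rw [abs_of_pos ht] at k1 k2
  generalize c / (S + 1) = t at *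
  have : 2 * |C| * t ≤ (lam * a ^ (γ - 1) + c) * t := by
    rcases abs_cases C with ⟨hh, _⟩ | ⟨hh, _⟩ <;> rw [hh] <;> nlinarith
  exact le_of_mul_le_mul_right this ht

end Minimizers

/-! ### Error rates, exact zeros and the linear expansion for fixed n -/

section DeterministicBounds

variable {n : ℕ} {ι : Type*} [Fintype ι]

/-- A crude bound for the estimation error from the basic inequality. -/
lemma mul_dotProduct_self_le_of_basic [DecidableEq ι] {X : Matrix (Fin n) ι ℝ} {v u : ι → ℝ}
    {E K p : ℝ} (hn : 0 < n) (hp : 0 ≤ p) (hK : 0 ≤ K) (hρ : 0 < minEigenvalue (gram X))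
    (hQ : v ⬝ᵥ ((gram X)⁻¹ *ᵥ v) ≤ K * (n * p))
    (h : (n : ℝ) * (u ⬝ᵥ (gram X *ᵥ u)) ≤ 2 * (v ⬝ᵥ u) + E) :
    n * minEigenvalue (gram X) * (u ⬝ᵥ u) ≤ 4 * K * p + 2 * E := by
  have hn' : (0 : ℝ) < n := by exact_mod_cast hn
  have hG := posDef_of_minEigenvalue_pos (gram_isHermitian X) hρ
  have h1 := minEigenvalue_mul_le (gram_isHermitian X) u
  have h0 : 0 ≤ u ⬝ᵥ (gram X *ᵥ u) := by
    simpa using hG.posSemidef.dotProduct_mulVec_nonneg u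
  have h2 : (v ⬝ᵥ u) ^ 2 ≤ K * p * (n * (u ⬝ᵥ (gram X *ᵥ u))) :=
    calc (v ⬝ᵥ u) ^ 2 ≤ (v ⬝ᵥ ((gram X)⁻¹ *ᵥ v)) * (u ⬝ᵥ (gram X *ᵥ u)) := sq_dotProduct_le hG v u
      _ ≤ K * (n * p) * (u ⬝ᵥ (gram X *ᵥ u)) := by gcongr
      _ = _ := by ring
  have h3 : n * minEigenvalue (gram X) * (u ⬝ᵥ u) ≤ n * (u ⬝ᵥ (gram X *ᵥ u)) := by
    rw [mul_assoc]; gcongr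
  have h4 : 0 ≤ n * (u ⬝ᵥ (gram X *ᵥ u)) := by positivity
  generalize (n : ℝ) * (u ⬝ᵥ (gram X *ᵥ u)) = U at *
  -- AM–GM: half of U is absorbed on the left of the basic inequality.
  have h5 : 2 * (v ⬝ᵥ u) ≤ U / 2 + 2 * (K * p) := by
    refine le_of_abs_le (abs_le_of_sq_le_sq (a := 2 * (v ⬝ᵥ u)) ?_ (by positivity))
    nlinarith [sq_nonneg (U / 2 - 2 * (K * p))]
  linarith

lemma sum_abs_le_sqrt_card_mul (u : ι → ℝ) :
    ∑ j, |u j| ≤ √(Fintype.card ι) * √(u ⬝ᵥ u) := by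
  rw [← Real.sqrt_mul (Nat.cast_nonneg _)]
  refine Real.le_sqrt_of_sq_le ?_
  have := sq_sum_le_card_mul_sum_sq (s := Finset.univ) (f := fun j => |u j|)
  simpa [dotProduct, sq] using this

lemma abs_le_sqrt_dotProduct (u : ι → ℝ) (j : ι) : |u j| ≤ √(u ⬝ᵥ u) := by
  refine Real.abs_le_sqrt ?_
  rw [sq]
  exact Finset.single_le_sum (f := fun j => u j * u j) (fun i _ => mul_self_nonneg _)
    (Finset.mem_univ j)

variable {k m : ℕ}

/-- The change of the penalty when all the nonzero coefficients are bounded away from zero. -/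
lemma sum_rpow_sub_sum_rpow_le {β₀ β : EuclideanSpace ℝ (Fin k ⊕ Fin m)} {γ a : ℝ} (hγ0 : 0 < γ)
    (hγ1 : γ < 1) (ha : 0 < a) (h2 : ∀ j, β₀ (Sum.inr j) = 0) (h1 : ∀ j, a ≤ |β (Sum.inl j)|) :
    ∑ j, |β₀ j| ^ γ - ∑ j, |β j| ^ γ ≤
      a ^ (γ - 1) * (√k * √((β.ofLp - β₀.ofLp) ⬝ᵥ (β.ofLp - β₀.ofLp))) := by
  have hle : ∑ j, |β₀ j| ^ γ - ∑ j, |β j| ^ γ ≤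
      ∑ j : Fin k, a ^ (γ - 1) * |(β.ofLp - β₀.ofLp) (Sum.inl j)| := by
    rw [Fintype.sum_sum_type, Fintype.sum_sum_type]
    have e1 : ∑ j : Fin m, |β₀ (Sum.inr j)| ^ γ = 0 :=
      Finset.sum_eq_zero fun j _ => by rw [h2, abs_zero, Real.zero_rpow hγ0.ne']
    have e2 : 0 ≤ ∑ j : Fin m, |β (Sum.inr j)| ^ γ :=
      Finset.sum_nonneg fun j _ => by positivity
    have e3 : ∑ j : Fin k, |β₀ (Sum.inl j)| ^ γ - ∑ j : Fin k, |β (Sum.inl j)| ^ γ ≤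
        ∑ j : Fin k, a ^ (γ - 1) * |(β.ofLp - β₀.ofLp) (Sum.inl j)| := by
      rw [← Finset.sum_sub_distrib]
      refine Finset.sum_le_sum fun j _ => ?_
      refine (rpow_sub_rpow_le hγ0 hγ1 ha (abs_nonneg _) (h1 j)).trans ?_
      rw [Pi.sub_apply, abs_sub_comm (β _)]
      exact mul_le_mul_of_nonneg_left (abs_abs_sub_abs_le_abs_sub _ _) (by positivity)
    linarith
  refine hle.trans ?_
  rw [← Finset.mul_sum]
  refine mul_le_mul_of_nonneg_left ?_ (by positivity)
  refine (sum_abs_le_sqrt_card_mul fun j : Fin k => (β.ofLp - β₀.ofLp) (Sum.inl j)).trans ?_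
  rw [Fintype.card_fin]
  refine mul_le_mul_of_nonneg_left (Real.sqrt_le_sqrt ?_) (by positivity)
  rw [dotProduct, dotProduct, Fintype.sum_sum_type]
  exact le_add_of_nonneg_right (Finset.sum_nonneg fun j _ => mul_self_nonneg _)

/-- The sharp rate, once the nonzero coefficients are estimated consistently. -/
lemma sqrt_dotProduct_self_le_of_basic [DecidableEq ι] {X : Matrix (Fin n) ι ℝ} {v u : ι → ℝ}
    {D K p : ℝ} (hn : 0 < n) (hp : 1 ≤ p) (hK : 0 ≤ K) (hρ : 0 < minEigenvalue (gram X))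
    (hQ : v ⬝ᵥ v ≤ K * (n * p)) (hD0 : 0 ≤ D)
    (h : (n : ℝ) * (u ⬝ᵥ (gram X *ᵥ u)) ≤ 2 * (v ⬝ᵥ u) + D * √n * √(u ⬝ᵥ u)) :
    √(u ⬝ᵥ u) ≤ (2 * √K + D) * (√n * √p / (n * minEigenvalue (gram X))) := by
  have hn' : (0 : ℝ) < n := by exact_mod_cast hn
  have h1 := minEigenvalue_mul_le (gram_isHermitian X) u
  have huu := dotProduct_self_nonneg_of_real u
  have h2 : v ⬝ᵥ u ≤ √K * (√n * √p) * √(u ⬝ᵥ u) := by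
    rw [← Real.sqrt_mul hn'.le, ← Real.sqrt_mul hK, ← Real.sqrt_mul (by positivity)]
    refine Real.le_sqrt_of_sq_le ((sq_dotProduct_le_mul v u).trans ?_)
    gcongr
  -- Since p ≥ 1, the penalty contribution is dominated by the noise rate √(np).
  have h3 : D * √n * √(u ⬝ᵥ u) ≤ D * (√n * √p) * √(u ⬝ᵥ u) := by
    gcongr
    exact le_mul_of_one_le_right (by positivity) (Real.one_le_sqrt.2 hp)
  have h4 : n * minEigenvalue (gram X) * (√(u ⬝ᵥ u) * √(u ⬝ᵥ u)) ≤
      (2 * √K + D) * (√n * √p) * √(u ⬝ᵥ u) := by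
    rw [Real.mul_self_sqrt huu]
    have : n * (minEigenvalue (gram X) * (u ⬝ᵥ u)) ≤ n * (u ⬝ᵥ (gram X *ᵥ u)) := by gcongr
    linarith
  rw [← mul_div_assoc, le_div_iff₀ (by positivity)]
  rcases (Real.sqrt_nonneg (u ⬝ᵥ u)).eq_or_lt with h0 | h0
  · rw [← h0, zero_mul]; positivity
  · refine le_of_mul_le_mul_right ?_ h0
    linarith

/-- A coordinate smaller than the thresholding level vanishes. -/
lemma IsBridgeEstimate.eq_zero_of_abs_le [DecidableEq ι] {X : Matrix (Fin n) ι ℝ} {Y : Fin n → ℝ}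
    {β : EuclideanSpace ℝ ι} {lam γ C ρ p : ℝ} (hγ0 : 0 < γ) (hγ1 : γ < 1) (hn : 0 < n)
    (hC : 0 ≤ C) (hρ : 0 < ρ) (hp : 0 < p)
    (h : IsBridgeEstimate X Y lam γ β) {j : ι} (hj : (n : ℝ)⁻¹ * ∑ i, X i j ^ 2 = 1)
    (hβ : |β j| ≤ C * (√n * √p / (n * ρ)))
    (hlam : 2 * C ^ (2 - γ) < (2 - 2 ^ γ) * (lam * (n : ℝ) ^ (-γ / 2) * (ρ / √p) ^ (2 - γ))) :
    β j = 0 := by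
  by_contra hne
  have hn' : (0 : ℝ) < n := by exact_mod_cast hn
  have hX : ∑ i, X i j ^ 2 = n := by field_simp at hj; exact hj
  have h1 := h.threshold hγ0 j
  have hb : 0 < |β j| := abs_pos.2 hne
  have hsq : β j ^ 2 = |β j| ^ (2 - γ) * |β j| ^ γ := by
    rw [← Real.rpow_add hb, sub_add_cancel, Real.rpow_two, sq_abs]
  rw [hX, hsq, ← mul_assoc] at h1
  have h2 : lam * (2 - 2 ^ γ) ≤ 2 * n * |β j| ^ (2 - γ) := le_of_mul_le_mul_right h1 (by positivity)
  have hq : 0 < ρ / √p := by positivity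
  have hsqn : √(n : ℝ) = (n : ℝ) ^ (1 / 2 : ℝ) := Real.sqrt_eq_rpow _
  have h3 : √n * √p / (n * ρ) = (n : ℝ) ^ (-1 / 2 : ℝ) * (ρ / √p)⁻¹ := by
    rw [show (-1 / 2 : ℝ) = 1 / 2 - 1 by norm_num, Real.rpow_sub_one hn'.ne', ← hsqn]
    field_simp
  have h4 : |β j| ^ (2 - γ) ≤ C ^ (2 - γ) * ((n : ℝ) ^ (γ / 2 - 1) * ((ρ / √p) ^ (2 - γ))⁻¹) := by
    refine (Real.rpow_le_rpow hb.le hβ (by linarith)).trans_eq ?_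
    rw [h3, Real.mul_rpow hC (by positivity), Real.mul_rpow (by positivity) (by positivity),
      ← Real.rpow_mul hn'.le, Real.inv_rpow hq.le]
    ring_nf
  -- The exponents 1, γ/2 - 1 and -γ/2 add up to zero, so the comparison with `hlam` is free of n.
  have h5 : (n : ℝ) * (n : ℝ) ^ (γ / 2 - 1) * (n : ℝ) ^ (-γ / 2) = 1 := by
    rw [Real.rpow_sub_one hn'.ne', mul_div_cancel₀ _ hn'.ne', ← Real.rpow_add hn']
    rw [show γ / 2 + -γ / 2 = 0 by ring, Real.rpow_zero]
  have hQ : 0 < (ρ / √p) ^ (2 - γ) := by positivity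
  have hN : 0 < (n : ℝ) ^ (-γ / 2) := by positivity
  refine absurd hlam (not_lt.2 ?_)
  generalize (ρ / √p) ^ (2 - γ) = Q at *
  calc (2 - 2 ^ γ) * (lam * (n : ℝ) ^ (-γ / 2) * Q)
      = (lam * (2 - 2 ^ γ)) * ((n : ℝ) ^ (-γ / 2) * Q) := by ring
    _ ≤ 2 * n * |β j| ^ (2 - γ) * ((n : ℝ) ^ (-γ / 2) * Q) := by gcongr
    _ ≤ 2 * n * (C ^ (2 - γ) * ((n : ℝ) ^ (γ / 2 - 1) * Q⁻¹)) * ((n : ℝ) ^ (-γ / 2) * Q) := by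
        gcongr
    _ = 2 * C ^ (2 - γ) * ((n : ℝ) * (n : ℝ) ^ (γ / 2 - 1) * (n : ℝ) ^ (-γ / 2)) * (Q⁻¹ * Q) := by
        ring
    _ = 2 * C ^ (2 - γ) := by rw [h5, inv_mul_cancel₀ hQ.ne', mul_one, mul_one]

/-- The remainder of the linear expansion, in terms of the bound `D / 2` for the scores of the
estimated model. -/
lemma abs_standardizedError_sub_oracleTerm_le {X : Matrix (Fin n) (Fin k ⊕ Fin m) ℝ}
    {β₀ β : EuclideanSpace ℝ (Fin k ⊕ Fin m)} {e : Fin n → ℝ} {σ τ D : ℝ} (hn : 0 < n)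
    (hσ : 0 < σ) (hτ : 0 < τ) (hD : 0 ≤ D) (hτ1 : τ ≤ minEigenvalue (gram (design1 X)))
    (h0 : ∀ j, β₀ (Sum.inr j) = 0) (h : ∀ j, β (Sum.inr j) = 0)
    (hscore : ∀ j : Fin k, 2 * |∑ i, X i (Sum.inl j) *
      (response X β₀ e i - ∑ l, X i l * β l)| ≤ D)
    {α : EuclideanSpace ℝ (Fin k)} (hα : α ≠ 0) :
    |standardizedError n σ (gram (design1 X)) α (block1 β) (block1 β₀) -
      oracleTerm σ (design1 X) e α| ≤ D * √(k / n) / (2 * σ * √τ) := by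
  set W := design1 X with hW
  set S := gram W with hS
  have hn' : (0 : ℝ) < n := by exact_mod_cast hn
  have hS1 : S.IsHermitian := gram_isHermitian W
  have hP : S.PosDef := posDef_of_minEigenvalue_pos hS1 (hτ.trans_le hτ1)
  set u : Fin k → ℝ := (block1 β - block1 β₀).ofLp with hu
  -- With both second blocks zero, e - Wu is the full residual, so c is the first-block score
  -- vector.
  set c : Fin k → ℝ := Wᵀ *ᵥ (e - W *ᵥ u) with hc
  have hcj (j : Fin k) : |c j| ≤ D / 2 := by
    have : c j = ∑ i, X i (Sum.inl j) * (response X β₀ e i - ∑ l, X i l * β l) := by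
      rw [hc, Matrix.mulVec, dotProduct]
      refine Finset.sum_congr rfl fun i _ => ?_
      have hi : (W *ᵥ u) i = ∑ l, X i (Sum.inl l) * β (Sum.inl l) -
          ∑ l, X i (Sum.inl l) * β₀ (Sum.inl l) := by
        rw [← Finset.sum_sub_distrib]
        rw [Matrix.mulVec, dotProduct]
        exact Finset.sum_congr rfl fun l _ => mul_sub (X i (Sum.inl l)) _ _
      simp only [response, Fintype.sum_sum_type, h0, h, Pi.sub_apply, hi]
      simp only [mul_zero, Finset.sum_const_zero, add_zero]
      change X i (Sum.inl j) * _ = _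
      ring
    rw [this]
    linarith [hscore j]
  have hcc : c ⬝ᵥ c ≤ k * (D / 2) ^ 2 := by
    calc c ⬝ᵥ c ≤ ∑ _j : Fin k, (D / 2) ^ 2 := by
          refine Finset.sum_le_sum fun j _ => ?_
          rw [← sq, ← sq_abs]
          exact pow_le_pow_left₀ (abs_nonneg _) (hcj j) 2
      _ = k * (D / 2) ^ 2 := by simp
  set q := α.ofLp ⬝ᵥ (S⁻¹ *ᵥ α.ofLp) with hq
  have hα' : α.ofLp ≠ 0 := fun h => hα (by ext j; exact congrFun h j)
  have hq0 : 0 < q := dotProduct_inv_mulVec_pos hP hα'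
  have hsd : asympSD σ S α = σ * √q := by
    rw [asympSD, Real.sqrt_mul (sq_nonneg _), Real.sqrt_sq hσ.le]
  have hsum : ∑ i, e i * (α.ofLp ⬝ᵥ (S⁻¹ *ᵥ W i)) = α.ofLp ⬝ᵥ (S⁻¹ *ᵥ (Wᵀ *ᵥ e)) := by
    rw [Matrix.mulVec_transpose, Matrix.vecMul_eq_sum, Matrix.mulVec_sum, dotProduct_sum]
    refine Finset.sum_congr rfl fun i _ => ?_
    rw [Matrix.mulVec_smul, dotProduct_smul, smul_eq_mul]
  have hlin : α.ofLp ⬝ᵥ (S⁻¹ *ᵥ (Wᵀ *ᵥ e)) = n * (α.ofLp ⬝ᵥ u) + α.ofLp ⬝ᵥ (S⁻¹ *ᵥ c) := by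
    have : Wᵀ *ᵥ (W *ᵥ u) = (n : ℝ) • (S *ᵥ u) := by
      rw [Matrix.mulVec_mulVec, ← smul_gram hn, Matrix.smul_mulVec]
    rw [hc, Matrix.mulVec_sub, this, Matrix.mulVec_sub, Matrix.mulVec_smul, inv_mulVec_mulVec hP,
      dotProduct_sub, dotProduct_smul, smul_eq_mul]
    ring
  have hR : standardizedError n σ S α (block1 β) (block1 β₀) - oracleTerm σ W e α =
      -((√n)⁻¹ * (σ * √q)⁻¹ * (α.ofLp ⬝ᵥ (S⁻¹ *ᵥ c))) := by
    rw [standardizedError, oracleTerm, ← hS, hsd, hsum, hlin, ← hu]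
    have : (√(n : ℝ))⁻¹ * n = √n := by
      rw [inv_mul_eq_iff_eq_mul₀ (by positivity), Real.mul_self_sqrt hn'.le]
    linear_combination (σ * √q)⁻¹ * (α.ofLp ⬝ᵥ u) * (-this)
  -- Cauchy–Schwarz in S⁻¹ splits off √q, which cancels against s = σ√q; this makes the bound
  -- independent of α.
  have hbound : |α.ofLp ⬝ᵥ (S⁻¹ *ᵥ c)| ≤ √q * (√k * (D / 2) / √τ) := by
    rw [show √k * (D / 2) / √τ = √(k * (D / 2) ^ 2 / τ) by
      rw [Real.sqrt_div (by positivity), Real.sqrt_mul (by positivity),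
        Real.sqrt_sq (by positivity)], ← Real.sqrt_mul hq0.le]
    refine Real.abs_le_sqrt ((sq_dotProduct_inv_mulVec_le hP _ _).trans ?_)
    refine mul_le_mul_of_nonneg_left ?_ hq0.le
    rw [le_div_iff₀ hτ, mul_comm]
    exact (mul_dotProduct_inv_mulVec_le hS1 hτ hτ1 c).trans hcc
  rw [hR, abs_neg, abs_mul, abs_of_pos (by positivity)]
  refine (mul_le_mul_of_nonneg_left hbound (by positivity)).trans_eq ?_
  have hq1 : √q ≠ 0 := by positivity
  rw [Real.sqrt_div (by positivity)]
  field_simp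

end DeterministicBounds

/-! ### Weights of the leading term and limits of probabilities -/

section Asymptotics

/-- The sum of squares of the weights in the oracle term and a bound for each weight. -/
lemma oracle_weights {n k : ℕ} {W : Matrix (Fin n) (Fin k) ℝ} {σ τ : ℝ} (hn : 0 < n) (hσ : 0 < σ)
    (hτ : 0 < τ) (hτ1 : τ ≤ minEigenvalue (gram W)) {α : EuclideanSpace ℝ (Fin k)} (hα : α ≠ 0) :
    ∑ i, (σ * ((√n)⁻¹ * (asympSD σ (gram W) α)⁻¹ *
      (α.ofLp ⬝ᵥ ((gram W)⁻¹ *ᵥ W i)))) ^ 2 = 1 ∧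
    ∀ i, (σ * ((√n)⁻¹ * (asympSD σ (gram W) α)⁻¹ *
      (α.ofLp ⬝ᵥ ((gram W)⁻¹ *ᵥ W i)))) ^ 2 ≤ (n : ℝ)⁻¹ * (W i ⬝ᵥ W i) / τ := by
  have hn' : (0 : ℝ) < n := by exact_mod_cast hn
  have hS1 := gram_isHermitian W
  have hP := posDef_of_minEigenvalue_pos hS1 (hτ.trans_le hτ1)
  have hα' : α.ofLp ≠ 0 := fun h => hα (by ext j; exact congrFun h j)
  have hq0 := dotProduct_inv_mulVec_pos hP hα'
  have hsq (i : Fin n) : (σ * ((√n)⁻¹ * (asympSD σ (gram W) α)⁻¹ *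
      (α.ofLp ⬝ᵥ ((gram W)⁻¹ *ᵥ W i)))) ^ 2 =
      (n : ℝ)⁻¹ * (α.ofLp ⬝ᵥ ((gram W)⁻¹ *ᵥ α.ofLp))⁻¹ *
        (α.ofLp ⬝ᵥ ((gram W)⁻¹ *ᵥ W i)) ^ 2 := by
    rw [asympSD, mul_pow, mul_pow, mul_pow, inv_pow, inv_pow, Real.sq_sqrt hn'.le,
      Real.sq_sqrt (by positivity)]
    field_simp
  simp only [hsq]
  constructor
  -- The inner products are the entries of W S⁻¹α, whose squared length is n α'S⁻¹α because W'W =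
  -- nS.
  · have h1 (i : Fin n) : α.ofLp ⬝ᵥ ((gram W)⁻¹ *ᵥ W i) = (W *ᵥ ((gram W)⁻¹ *ᵥ α.ofLp)) i := by
      rw [dotProduct_mulVec_comm hS1.inv]; rfl
    rw [← Finset.mul_sum]
    simp only [h1]
    have h2 : ∑ i, (W *ᵥ ((gram W)⁻¹ *ᵥ α.ofLp)) i ^ 2 =
        n * (α.ofLp ⬝ᵥ ((gram W)⁻¹ *ᵥ α.ofLp)) := by
      have := mul_dotProduct_gram_mulVec hn W ((gram W)⁻¹ *ᵥ α.ofLp)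
      rw [mulVec_inv_mulVec hP, dotProduct_comm _ α.ofLp] at this
      rw [this, dotProduct]
      exact Finset.sum_congr rfl fun i _ => sq _
    rw [h2]
    field_simp
  · intro i
    rw [mul_assoc, mul_div_assoc]
    refine mul_le_mul_of_nonneg_left ?_ (by positivity)
    rw [inv_mul_le_iff₀ hq0]
    refine (sq_dotProduct_inv_mulVec_le hP _ _).trans ?_
    refine mul_le_mul_of_nonneg_left ?_ hq0.le
    rw [le_div_iff₀ hτ, mul_comm]
    exact mul_dotProduct_inv_mulVec_le hS1 hτ hτ1 _

/-- A sequence of measures of sets vanishes if the sets are eventually covered by events whose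
probability is `O(1/K)`, for every `K`. -/
lemma tendsto_measure_zero_of_forall_le {Ω : Type*} [MeasurableSpace Ω] {P : Measure Ω}
    {s : ℕ → Set Ω} {a : ℝ}
    (h : ∀ K : ℝ, 0 < K → ∀ᶠ n in atTop, P (s n) ≤ ENNReal.ofReal (a / K)) :
    Tendsto (fun n => P (s n)) atTop (𝓝 0) := by
  rw [ENNReal.tendsto_nhds_zero]
  intro c hc
  have h1 : Tendsto (fun K : ℝ => ENNReal.ofReal (a / K)) atTop (𝓝 0) := by
    have := ENNReal.tendsto_ofReal (tendsto_const_nhds.div_atTop (a := a) tendsto_id)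
    simpa using this
  obtain ⟨K, hK, hK0⟩ :=
    ((ENNReal.tendsto_nhds_zero.1 h1 c hc).and (eventually_gt_atTop 0)).exists
  filter_upwards [h K hK0] with n hn using hn.trans hK

lemma tendsto_measure_one_of_compl {Ω : Type*} [MeasurableSpace Ω] {P : Measure Ω}
    [IsProbabilityMeasure P] {s : ℕ → Set Ω} (hs : ∀ n, NullMeasurableSet (s n) P)
    (h : Tendsto (fun n => P (s n)ᶜ) atTop (𝓝 0)) : Tendsto (fun n => P (s n)) atTop (𝓝 1) := by
  have h1 (n : ℕ) : P (s n) = 1 - P (s n)ᶜ := by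
    rw [← prob_compl_eq_one_sub₀ (hs n).compl, compl_compl]
  simp only [h1]
  simpa using ENNReal.Tendsto.sub tendsto_const_nhds h (Or.inl ENNReal.one_ne_top)

end Asymptotics

/-! ### The deterministic argument for large n -/

section BridgeAsymptotics

variable {γ : ℝ} {k m : ℕ → ℕ} {X : ∀ n, Matrix (Fin n) (Fin (k n) ⊕ Fin (m n)) ℝ} {lam : ℕ → ℝ}
  {β₀ : ∀ n, EuclideanSpace ℝ (Fin (k n) ⊕ Fin (m n))}

/-- On the event that the two noise quadratic forms are at most `K n p`, a bridge estimate
eventually selects the true model and has a small remainder in its linear expansion. -/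
lemma eventually_oracle_of_quadratic_forms_le (hγ0 : 0 < γ) (hγ1 : γ < 1)
    (hp : ∀ᶠ n in atTop, 0 < k n)
    (hβ2 : ∀ᶠ n in atTop, block2 (β₀ n) = 0)
    (hscale : ∀ᶠ n : ℕ in atTop, ∀ j, (n : ℝ)⁻¹ * ∑ i, X n i j ^ 2 = 1)
    (hlam : ∀ᶠ n in atTop, 0 < lam n)
    (hA2a : ∀ᶠ n in atTop, 0 < minEigenvalue (gram (X n)))
    (hA2b : Tendsto (fun n : ℕ => (((k n + m n : ℕ) : ℝ) + lam n * (k n : ℝ)) *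
      ((n : ℝ) * minEigenvalue (gram (X n)))⁻¹) atTop (𝓝 0))
    (hA3a : Tendsto (fun n : ℕ => lam n * √((k n : ℝ) / (n : ℝ))) atTop (𝓝 0))
    (hA3b : Tendsto (fun n : ℕ => lam n * (n : ℝ) ^ (-γ / 2) *
      (minEigenvalue (gram (X n)) / √((k n + m n : ℕ) : ℝ)) ^ (2 - γ)) atTop atTop)
    {b₀ b₁ : ℝ} (hb₀ : 0 < b₀) (hA4 : ∀ᶠ n in atTop, ∀ j,
      b₀ ≤ |block1 (β₀ n) j| ∧ |block1 (β₀ n) j| ≤ b₁)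
    {τ : ℝ} (hτ : 0 < τ) (hA5a : ∀ᶠ n in atTop, τ ≤ minEigenvalue (gram (design1 (X n))))
    {σ : ℝ} (hσ : 0 < σ) {K : ℝ} (hK : 0 < K) {δ : ℝ} (hδ : 0 < δ) :
    ∀ᶠ n in atTop, ∀ (e : Fin n → ℝ) (β : EuclideanSpace ℝ (Fin (k n) ⊕ Fin (m n))),
      IsBridgeEstimate (X n) (response (X n) (β₀ n) e) (lam n) γ β →
      ((X n)ᵀ *ᵥ e) ⬝ᵥ ((gram (X n))⁻¹ *ᵥ ((X n)ᵀ *ᵥ e)) ≤ K * (n * ((k n + m n : ℕ) : ℝ)) →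
      ((X n)ᵀ *ᵥ e) ⬝ᵥ ((X n)ᵀ *ᵥ e) ≤ K * (n * ((k n + m n : ℕ) : ℝ)) →
      block2 β = 0 ∧ ∀ α : EuclideanSpace ℝ (Fin (k n)), α ≠ 0 →
        |standardizedError n σ (gram (design1 (X n))) α (block1 β) (block1 (β₀ n)) -
          oracleTerm σ (design1 (X n)) e α| < δ := by
  -- An error of at most b₀/2 leaves the nonzero coefficients at least b₀/2 in modulus.
  set a : ℝ := b₀ / 2 with ha
  have ha0 : 0 < a := by positivity
  set C₁ : ℝ := 4 * K + 2 * b₁ ^ γ with hC₁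
  set D : ℝ := a ^ (γ - 1) with hD
  have hD0 : 0 < D := by positivity
  set C₂ : ℝ := 2 * √K + D with hC₂
  have hC₂0 : 0 < C₂ := by positivity
  have h2γ : (2 : ℝ) ^ γ < 2 := by
    simpa using Real.rpow_lt_rpow_of_exponent_lt (x := 2) one_lt_two hγ1
  have hcons : ∀ᶠ n : ℕ in atTop, C₁ * ((((k n + m n : ℕ) : ℝ) + lam n * (k n : ℝ)) *
      ((n : ℝ) * minEigenvalue (gram (X n)))⁻¹) < a ^ 2 := by
    have := hA2b.const_mul C₁
    rw [mul_zero] at this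
    exact this.eventually_lt_const (by positivity)
  have hrem : ∀ᶠ n : ℕ in atTop, D / (2 * σ * √τ) * (lam n * √((k n : ℝ) / (n : ℝ))) < δ := by
    have := hA3a.const_mul (D / (2 * σ * √τ))
    rw [mul_zero] at this
    exact this.eventually_lt_const hδ
  filter_upwards [hp, hβ2, hscale, hlam, hA2a, hcons, hrem, hA4, hA5a, eventually_gt_atTop 0,
    hA3a.eventually_lt_const one_pos, hA3b.eventually_gt_atTop (2 * C₂ ^ (2 - γ) / (2 - 2 ^ γ))]
    with n hk hβ2 hscale hlam hρ hcons hrem hA4 hτ1 hn hle1 hthr e β hmin hQ1 hQ2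
  have hn' : (0 : ℝ) < n := by exact_mod_cast hn
  set p : ℝ := ((k n + m n : ℕ) : ℝ) with hpdef
  have hp1 : 1 ≤ p := by
    rw [hpdef]; exact_mod_cast (show 1 ≤ k n + m n by omega)
  set ρ := minEigenvalue (gram (X n)) with hρdef
  set u : Fin (k n) ⊕ Fin (m n) → ℝ := β.ofLp - (β₀ n).ofLp with hu
  have hb₁ : 0 ≤ b₁ := (abs_nonneg _).trans (hA4 ⟨0, hk⟩).2
  have h0 (j : Fin (m n)) : β₀ n (Sum.inr j) = 0 := congrFun (congrArg WithLp.ofLp hβ2) j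
  have hbasic := hmin.basic_inequality hn
  rw [← hu] at hbasic
  have hpen : ∑ j, |β₀ n j| ^ γ - ∑ j, |β j| ^ γ ≤ k n * b₁ ^ γ := by
    have e1 : ∑ j, |β₀ n j| ^ γ ≤ k n * b₁ ^ γ := by
      rw [Fintype.sum_sum_type, Finset.sum_eq_zero (s := (Finset.univ : Finset (Fin (m n))))
        fun j _ => by rw [h0, abs_zero, Real.zero_rpow hγ0.ne'], add_zero]
      calc ∑ j : Fin (k n), |β₀ n (Sum.inl j)| ^ γ ≤ ∑ _j : Fin (k n), b₁ ^ γ :=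
            Finset.sum_le_sum fun j _ => Real.rpow_le_rpow (abs_nonneg _) (hA4 j).2 hγ0.le
        _ = k n * b₁ ^ γ := by simp
    have e2 : 0 ≤ ∑ j, |β j| ^ γ := Finset.sum_nonneg fun j _ => by positivity
    linarith
  have huu : √(u ⬝ᵥ u) ≤ a := by
    have h1 := mul_dotProduct_self_le_of_basic hn (by linarith) hK.le hρ hQ1 (hbasic.trans
      (add_le_add_right (mul_le_mul_of_nonneg_left hpen hlam.le) _))
    have h2 : 4 * K * p + 2 * (lam n * (k n * b₁ ^ γ)) ≤ C₁ * (p + lam n * k n) := by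
      have e1 : 0 ≤ K * (lam n * k n) := by positivity
      have e2 : 0 ≤ b₁ ^ γ * p := by positivity
      rw [hC₁]
      linarith
    rw [← mul_assoc, mul_inv_lt_iff₀ (by positivity)] at hcons
    refine Real.sqrt_le_iff.2 ⟨ha0.le, ?_⟩
    refine le_of_mul_le_mul_left ?_ (show 0 < n * ρ by positivity)
    linarith
  have hβ1 (j : Fin (k n)) : a ≤ |β (Sum.inl j)| := by
    have e1 := abs_le_sqrt_dotProduct u (Sum.inl j)
    have e2 := (hA4 j).1
    have e3 := abs_sub_abs_le_abs_sub (β₀ n (Sum.inl j)) (β (Sum.inl j))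
    rw [abs_sub_comm] at e3
    have e4 : b₀ ≤ |β₀ n (Sum.inl j)| := e2
    have e5 : |β (Sum.inl j) - β₀ n (Sum.inl j)| ≤ √(u ⬝ᵥ u) := e1
    linarith
  -- This keeps the penalty's linear term within the order √n‖u‖ needed for the sharp rate.
  have hle2 : lam n * √(k n) ≤ √n := by
    rw [Real.sqrt_div (by positivity), ← mul_div_assoc, div_lt_one (by positivity)] at hle1
    exact hle1.le
  have hrate : √(u ⬝ᵥ u) ≤ C₂ * (√n * √p / (n * ρ)) := by
    refine sqrt_dotProduct_self_le_of_basic hn hp1 hK.le hρ hQ2 hD0.le (hbasic.trans ?_)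
    refine add_le_add_right ?_ _
    calc lam n * (∑ j, |β₀ n j| ^ γ - ∑ j, |β j| ^ γ)
        ≤ lam n * (D * (√(k n) * √(u ⬝ᵥ u))) :=
          mul_le_mul_of_nonneg_left (sum_rpow_sub_sum_rpow_le hγ0 hγ1 ha0 h0 hβ1) hlam.le
      _ = D * (lam n * √(k n)) * √(u ⬝ᵥ u) := by ring
      _ ≤ D * √n * √(u ⬝ᵥ u) := by gcongr
  have hzero (j : Fin (m n)) : β (Sum.inr j) = 0 := by
    refine hmin.eq_zero_of_abs_le (p := p) hγ0 hγ1 hn hC₂0.le hρ (by linarith) (hscale _) ?_ ?_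
    · have := (abs_le_sqrt_dotProduct u (Sum.inr j)).trans hrate
      simpa [hu, h0] using this
    · rw [div_lt_iff₀ (by linarith)] at hthr
      linarith
  refine ⟨by ext j; exact hzero j, fun α hα => ?_⟩
  refine (abs_standardizedError_sub_oracleTerm_le hn hσ hτ (by positivity) hτ1 h0 hzero
    (fun j => hmin.abs_score_le hγ0 hγ1 hlam.le ha0 (hβ1 j)) hα).trans_lt ?_
  refine lt_of_eq_of_lt ?_ hrem
  ring

end BridgeAsymptotics

end Bridge

/-! ### The oracle property -/

theorem theorem2
    {Ω : Type*} [MeasurableSpace Ω] (P : Measure Ω) [IsProbabilityMeasure P]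
    (γ : ℝ) (hγ0 : 0 < γ) (hγ1 : γ < 1)
    -- numbers of nonzero and of zero coefficients, designs, penalties, true coefficients
    (k m : ℕ → ℕ) (X : ∀ n, Matrix (Fin n) (Fin (k n) ⊕ Fin (m n)) ℝ) (lam : ℕ → ℝ)
    (β₀ : ∀ n, EuclideanSpace ℝ (Fin (k n) ⊕ Fin (m n)))
    (hβ1 : ∀ᶠ n in atTop, Bridge.block1 (β₀ n) ≠ 0)
    (hβ2 : ∀ᶠ n in atTop, Bridge.block2 (β₀ n) = 0)
    -- standardized covariates
    (hcenter : ∀ᶠ n in atTop, ∀ j, ∑ i, X n i j = 0)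
    (hscale : ∀ᶠ n : ℕ in atTop, ∀ j, (n : ℝ)⁻¹ * ∑ i, X n i j ^ 2 = 1)
    -- (A1)
    (ε : ℕ → Ω → ℝ) (σ : ℝ) (hσ : 0 < σ)
    (hindep : iIndepFun ε P) (hident : ∀ i, IdentDistrib (ε i) (ε 0) P P)
    (hL2 : ∀ i, MemLp (ε i) 2 P) (hmean : ∀ i, ∫ ω, ε i ω ∂P = 0)
    (hvar : ∀ i, variance (ε i) P = σ ^ 2)
    -- (A2)
    (hA2a : ∀ᶠ n in atTop, 0 < Bridge.minEigenvalue (Bridge.gram (X n)))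
    (hA2b : Tendsto (fun n : ℕ => (((k n + m n : ℕ) : ℝ) + lam n * (k n : ℝ)) *
      ((n : ℝ) * Bridge.minEigenvalue (Bridge.gram (X n)))⁻¹) atTop (𝓝 0))
    -- (A3)
    (hA3a : Tendsto (fun n : ℕ => lam n * √((k n : ℝ) / (n : ℝ))) atTop (𝓝 0))
    (hA3b : Tendsto (fun n : ℕ => lam n * (n : ℝ) ^ (-γ / 2) *
      (Bridge.minEigenvalue (Bridge.gram (X n)) / √((k n + m n : ℕ) : ℝ)) ^ (2 - γ)) atTop atTop)
    -- (A4)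
    (hA4 : ∃ b₀ b₁ : ℝ, 0 < b₀ ∧ b₀ < b₁ ∧ ∀ᶠ n in atTop, ∀ j,
      b₀ ≤ |Bridge.block1 (β₀ n) j| ∧ |Bridge.block1 (β₀ n) j| ≤ b₁)
    -- (A5)
    (hA5a : ∃ τ₁ τ₂ : ℝ, 0 < τ₁ ∧ τ₁ < τ₂ ∧ ∀ᶠ n in atTop,
      τ₁ ≤ Bridge.minEigenvalue (Bridge.gram (Bridge.design1 (X n))) ∧
      Bridge.maxEigenvalue (Bridge.gram (Bridge.design1 (X n))) ≤ τ₂)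
    (hA5b : Tendsto (fun n : ℕ => (√(n : ℝ))⁻¹ *
      ⨆ i : Fin n, Bridge.design1 (X n) i ⬝ᵥ Bridge.design1 (X n) i) atTop (𝓝 0))
    -- the bridge estimator
    (βhat : ∀ n, Ω → EuclideanSpace ℝ (Fin (k n) ⊕ Fin (m n)))
    (hmeas : ∀ n, AEMeasurable (βhat n) P)
    (hmin : ∀ᶠ n in atTop, ∀ᵐ ω ∂P, Bridge.IsBridgeEstimate (X n)
      (Bridge.response (X n) (β₀ n) (fun i => ε i ω)) (lam n) γ (βhat n ω)) :
    -- (i) the zero coefficients are estimated as exactly zero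
    Tendsto (fun n => P {ω | Bridge.block2 (βhat n ω) = 0}) atTop (𝓝 1) ∧
    -- (ii) asymptotic linearity, uniformly in the direction
    (∀ δ : ℝ, 0 < δ → Tendsto (fun n => P {ω | ∃ α : EuclideanSpace ℝ (Fin (k n)),
        α ≠ 0 ∧ ‖α‖ ≤ 1 ∧
        δ ≤ |Bridge.standardizedError n σ (Bridge.gram (Bridge.design1 (X n))) α
              (Bridge.block1 (βhat n ω)) (Bridge.block1 (β₀ n)) -
            Bridge.oracleTerm σ (Bridge.design1 (X n)) (fun i => ε i ω) α|}) atTop (𝓝 0)) ∧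
    -- (ii) asymptotic normality
    (∀ α : ∀ n, EuclideanSpace ℝ (Fin (k n)), (∀ᶠ n in atTop, α n ≠ 0 ∧ ‖α n‖ ≤ 1) →
      TendstoInDistribution
        (fun n ω => Bridge.standardizedError n σ (Bridge.gram (Bridge.design1 (X n))) (α n)
          (Bridge.block1 (βhat n ω)) (Bridge.block1 (β₀ n)))
        atTop (id : ℝ → ℝ) (fun _ => P) (gaussianReal 0 1)) := by
  have hev : ∀ᶠ n in atTop, 0 < k n := by
    filter_upwards [hβ1] with n hn
    refine Nat.pos_of_ne_zero fun h => hn ?_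
    ext j
    exact absurd j.2 (by omega)
  -- The sign of the penalty comes from the divergence in `hA3b`, whose other factors are
  -- nonnegative.
  have hlam : ∀ᶠ n in atTop, 0 < lam n := by
    filter_upwards [hA3b.eventually_gt_atTop 0, hA2a] with n hn hρ
    by_contra hle
    have h1 : 0 ≤ (n : ℝ) ^ (-γ / 2) *
        (Bridge.minEigenvalue (Bridge.gram (X n)) / √((k n + m n : ℕ) : ℝ)) ^ (2 - γ) := by
      positivity
    rw [mul_assoc] at hn
    exact absurd hn (not_lt.2 (mul_nonpos_of_nonpos_of_nonneg (not_lt.1 hle) h1))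
  obtain ⟨b₀, b₁, hb₀, -, hA4⟩ := hA4
  obtain ⟨τ, τ₂, hτ, -, hA5a⟩ := hA5a
  replace hA5a := hA5a.mono fun n hn => hn.1
  have key {δ : ℝ} (hδ : 0 < δ) : Tendsto (fun n => P {ω | ¬ (Bridge.block2 (βhat n ω) = 0 ∧
      ∀ α : EuclideanSpace ℝ (Fin (k n)), α ≠ 0 →
        |Bridge.standardizedError n σ (Bridge.gram (Bridge.design1 (X n))) α
          (Bridge.block1 (βhat n ω)) (Bridge.block1 (β₀ n)) -
          Bridge.oracleTerm σ (Bridge.design1 (X n)) (fun i => ε i ω) α| < δ)}) atTop (𝓝 0) := by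
    -- Two Markov bounds, each contributing σ²/K.
    refine Bridge.tendsto_measure_zero_of_forall_le (a := 2 * σ ^ 2) fun K hK => ?_
    filter_upwards [Bridge.eventually_oracle_of_quadratic_forms_le hγ0 hγ1 hev hβ2 hscale hlam hA2a
      hA2b hA3a hA3b hb₀ hA4 hτ hA5a hσ hK hδ, hmin, hA2a, hscale, hev, eventually_gt_atTop 0]
      with n hdet hmin hρ hscale hk hn
    have hn' : (0 : ℝ) < n := by exact_mod_cast hn
    have hP := Bridge.posDef_of_minEigenvalue_pos (Bridge.gram_isHermitian (X n)) hρ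
    have hnp : 0 < (n : ℝ) * ((k n + m n : ℕ) : ℝ) := by
      have : 0 < k n + m n := by omega
      positivity
    obtain ⟨hI1, hE1⟩ := Bridge.integral_quadratic_form hindep hL2 hmean hvar (X n)
      (Bridge.gram (X n))⁻¹
    obtain ⟨hI2, hE2⟩ := Bridge.integral_quadratic_form hindep hL2 hmean hvar (X n) 1
    have ht1 : ((Bridge.gram (X n))⁻¹ * ((X n)ᵀ * X n)).trace = n * ((k n + m n : ℕ) : ℝ) := by
      rw [← Bridge.smul_gram hn, Matrix.mul_smul,
        Matrix.nonsing_inv_mul _ ((Matrix.isUnit_iff_isUnit_det _).1 hP.isUnit),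
        Matrix.trace_smul, Matrix.trace_one]
      simp
    -- Standardization makes every diagonal entry of X'X equal to n.
    have ht2 : (1 * ((X n)ᵀ * X n)).trace = n * ((k n + m n : ℕ) : ℝ) := by
      rw [Matrix.one_mul, Matrix.trace]
      have (j : Fin (k n) ⊕ Fin (m n)) : ((X n)ᵀ * X n).diag j = n := by
        have := hscale j
        rw [inv_mul_eq_iff_eq_mul₀ hn'.ne', mul_one] at this
        rw [← this, Matrix.diag_apply, Matrix.mul_apply]
        exact Finset.sum_congr rfl fun i _ => (sq _).symm
      simp only [this]
      simp [mul_comm]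
    rw [ht1] at hE1
    rw [ht2] at hE2
    have hM1 := Bridge.measure_lt_le_of_integral_eq hI1
      (fun ω => Bridge.dotProduct_inv_mulVec_nonneg hP _) hK hnp hE1
    simp only [Matrix.one_mulVec] at hI2 hE2
    have hM2 := Bridge.measure_lt_le_of_integral_eq hI2
      (fun ω => Bridge.dotProduct_self_nonneg_of_real _) hK hnp hE2
    -- Covering by the two Markov events needs no measurability of the bad event, which quantifies
    -- over all directions.
    refine (measure_mono_ae ?_).trans
      ((measure_union_le _ _).trans ((add_le_add hM1 hM2).trans_eq ?_))
    · filter_upwards [hmin] with ω hω hbad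
      by_contra hgood
      have h1 := fun h => hgood (Or.inl h)
      have h2 := fun h => hgood (Or.inr h)
      exact hbad (hdet _ _ hω (not_lt.1 h1) (not_lt.1 h2))
    · rw [← ENNReal.ofReal_add (by positivity) (by positivity)]
      congr 1
      ring
  refine ⟨?_, fun δ hδ => ?_, fun α hα => ?_⟩
  · refine Bridge.tendsto_measure_one_of_compl (fun n => ?_) ?_
    · have hb : Measurable (Bridge.block2 : EuclideanSpace ℝ (Fin (k n) ⊕ Fin (m n)) → _) := by
        unfold Bridge.block2
        fun_prop
      exact (hb.comp_aemeasurable (hmeas n)).nullMeasurableSet_preimage (measurableSet_singleton 0)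
    · refine tendsto_of_tendsto_of_tendsto_of_le_of_le tendsto_const_nhds (key one_pos)
        (fun n => zero_le) fun n => measure_mono ?_
      intro ω hω h
      exact hω h.1
  · refine tendsto_of_tendsto_of_tendsto_of_le_of_le tendsto_const_nhds (key hδ)
      (fun n => zero_le) fun n => measure_mono ?_
    rintro ω ⟨α, hα, -, hge⟩ h
    exact absurd (h.2 α hα) (not_lt.2 hge)
  -- The factor σ compensates for normalizing the noise to ε/σ.
  · let w : ∀ n, Fin n → ℝ := fun n i => σ * ((√n)⁻¹ *
      (Bridge.asympSD σ (Bridge.gram (Bridge.design1 (X n))) (α n))⁻¹ *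
      ((α n).ofLp ⬝ᵥ ((Bridge.gram (Bridge.design1 (X n)))⁻¹ *ᵥ Bridge.design1 (X n) i)))
    have hw : ∀ᶠ n in atTop, ∑ i, w n i ^ 2 = 1 := by
      filter_upwards [hA5a, hα, eventually_gt_atTop 0] with n hτ1 hα hn
      exact (Bridge.oracle_weights hn hσ hτ hτ1 hα.1).1
    have hwmax (δ : ℝ) (hδ : 0 < δ) : ∀ᶠ n in atTop, ∀ i, |w n i| ≤ δ := by
      filter_upwards [hA5a, hα, eventually_gt_atTop 0,
        hA5b.eventually_lt_const (show 0 < τ * δ ^ 2 by positivity)] with n hτ1 hα hn hlt i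
      refine abs_le_of_sq_le_sq ?_ hδ.le
      refine ((Bridge.oracle_weights hn hσ hτ hτ1 hα.1).2 i).trans ?_
      rw [div_le_iff₀ hτ, mul_comm _ τ]
      refine le_trans ?_ hlt.le
      have hn1 : (1 : ℝ) ≤ n := by exact_mod_cast hn
      have h1 : (n : ℝ)⁻¹ ≤ (√n)⁻¹ :=
        inv_anti₀ (by positivity) (Real.sqrt_le_iff.2 ⟨by positivity, by nlinarith⟩)
      have h2 := le_ciSup (Set.finite_range fun i : Fin n =>
        Bridge.design1 (X n) i ⬝ᵥ Bridge.design1 (X n) i).bddAbove i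
      exact mul_le_mul h1 h2 (Bridge.dotProduct_self_nonneg_of_real _) (by positivity)
    have hclt := Bridge.tendstoInDistribution_weighted_sum (P := P) (ε := fun i ω => ε i ω / σ)
      (hindep.comp (fun _ x => x / σ) fun _ => by fun_prop)
      (fun i => (hident i).comp (u := fun x => x / σ) (by fun_prop))
      (by rw [integral_div, hmean, zero_div])
      (by
        have := hvar 0
        rw [variance_of_integral_eq_zero (hL2 0).aemeasurable (hmean 0)] at this
        simp only [Pi.pow_apply, div_pow, integral_div, this]
        field_simp) w hw hwmax
    -- Slutsky: the remainder vanishes in probability by `key`.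
    refine tendstoInDistribution_of_tendstoInMeasure_sub _ _ hclt ?_ fun n => ?_
    · rw [tendstoInMeasure_iff_norm]
      intro δ hδ
      refine tendsto_of_tendsto_of_tendsto_of_le_of_le' tendsto_const_nhds (key hδ)
        (Eventually.of_forall fun n => zero_le) ?_
      filter_upwards [hα] with n hα
      refine measure_mono ?_
      intro ω hge h
      refine absurd (h.2 (α n) hα.1) (not_lt.2 ?_)
      have hor : Bridge.oracleTerm σ (Bridge.design1 (X n)) (fun i => ε i ω) (α n) =
          ∑ i, w n i * (ε i ω / σ) := by
        rw [Bridge.oracleTerm, Finset.mul_sum]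
        refine Finset.sum_congr rfl fun i _ => ?_
        simp only [w]
        field_simp
      rw [hor]
      simpa using hge
    · have hb : Measurable fun b : EuclideanSpace ℝ (Fin (k n) ⊕ Fin (m n)) =>
          Bridge.standardizedError n σ (Bridge.gram (Bridge.design1 (X n))) (α n)
            (Bridge.block1 b) (Bridge.block1 (β₀ n)) := by
        unfold Bridge.standardizedError Bridge.block1 dotProduct
        simp only [PiLp.sub_apply]
        fun_prop
      exact hb.comp_aemeasurable (hmeas n)
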